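/- Let $T=\{z\in\mathbb C:|z|=1\}$ and let $G$ be a second countable locally compact Hausdorff abelian group, written additively, which is $2$-regular, i.e. $x\mapsto 2x$ is a bijection of $G$. Let $m:G\times G\to T$ be a symplectic bicharacter: $m$ is continuous, is a character in each argument, satisfies $m(x,y)m(y,x)=1$ and $m(x,x)=1$ for all $x,y\in G$, and $y\mapsto m(\cdot,y)$ is an isomorphism of topological groups from $G$ onto its dual $\widehat G$. Let $L\subset G$ be a compact subgroup which is maximal isotropic for $m$ (maximal among the subgroups on which $m$ is identically $1$). Let $W$ be an $m$-representation of $G$ on a complex Hilbert space $\mathcal H$, not necessarily irreducible: a Borel map from $G$ into the unitary group of $\mathcal H$ with $W(0)=1$ and $W(x)W(y)=m(x,y)W(x+y)$ for all $x,y\in G$. Put $\mathcal H^L=\{\psi\in\mathcal H: W(a)\psi=\psi\ \text{for all } a\in L\}$ and $L/2=\{x\in G:2x\in L\}$. The operators $W(x)$, $x\in L/2$, map $\mathcal H^L$ onto itself, and $W^L$ denotes the resulting $m$-representation of $L/2$ on $\mathcal H^L$. A closed invariant subspace is called irreducible if it is nonzero and contains no closed invariant subspaces other than $0$ and itself. Then: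 1. $\mathcal H^L$ is an orthogonal (Hilbert space) direct sum of closed subspaces $\mathcal K_i$ which are irreducible under $W^L$. 2. $W$ is irreducible on $\mathcal H$ if and only if $\mathcal H^L$ is irreducible under $W^L$. 3. In particular, if $W$ is irreducible, then $\dim\mathcal H^L<\infty$. -/

import Mathlib

open MeasureTheory

noncomputable section

/-- A bicharacter of a topological abelian group `G`: a continuous map `G × G → T` into the circle
which is a character in each argument. -/
structure Bicharacter (G : Type*) [AddCommGroup G] [TopologicalSpace G] where
  toFun : G → G → Circle
  map_add_left : ∀ x y z, toFun (x + y) z = toFun x z * toFun y z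
  map_add_right : ∀ x y z, toFun x (y + z) = toFun x y * toFun x z
  continuous_toFun : Continuous fun p : G × G => toFun p.1 p.2

namespace Bicharacter

variable {G : Type*} [AddCommGroup G] [TopologicalSpace G]

instance : CoeFun (Bicharacter G) (fun _ => G → G → Circle) := ⟨toFun⟩

theorem map_zero_left (b : Bicharacter G) (y : G) : b 0 y = 1 := by
  have h := b.map_add_left 0 0 y
  rw [add_zero] at h
  exact (mul_eq_left.mp h.symm)

/-- The map `β_b : G → Ĝ`, `(x, β_b y) = b x y`. -/
def toDual (b : Bicharacter G) (y : G) : PontryaginDual (Multiplicative G) where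
  toFun x := b x.toAdd y
  map_one' := b.map_zero_left y
  map_mul' x x' := b.map_add_left x.toAdd x'.toAdd y
  continuous_toFun :=
    b.continuous_toFun.comp ((continuous_toAdd).prodMk continuous_const)

/-- Alternating (antisymmetric) bicharacters. -/
structure IsAlternating (b : Bicharacter G) : Prop where
  mul_swap : ∀ x y, b x y * b y x = 1
  self : ∀ x, b x x = 1

/-- Symplectic bicharacters: alternating, and `β_b` (which is always a homomorphism) is an
isomorphism of topological groups from `G` onto its dual. -/
structure IsSymplectic (b : Bicharacter G) : Prop where
  alternating : b.IsAlternating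
  isHomeomorph_toDual : IsHomeomorph b.toDual

/-- A subgroup `L` is isotropic for `b` if `b` is identically `1` on `L × L`. -/
def IsIsotropic (b : Bicharacter G) (L : AddSubgroup G) : Prop :=
  ∀ x ∈ L, ∀ y ∈ L, b x y = 1

/-- Maximal elements, with respect to inclusion, among the isotropic subgroups. -/
def IsMaximalIsotropic (b : Bicharacter G) (L : AddSubgroup G) : Prop :=
  Maximal b.IsIsotropic L

end Bicharacter

/-- `G` is 2-regular if `x ↦ 2x` is a bijection of `G`. -/
def IsTwoRegular (G : Type*) [AddCommGroup G] : Prop :=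
  Function.Bijective fun x : G => 2 • x

/-- `L/2`: the inverse image of `L` under `x ↦ 2x`. -/
def halfSubgroup {G : Type*} [AddCommGroup G] (L : AddSubgroup G) : AddSubgroup G :=
  L.comap (nsmulAddMonoidHom 2)

theorem mem_halfSubgroup {G : Type*} [AddCommGroup G] {L : AddSubgroup G} {x : G} :
    x ∈ halfSubgroup L ↔ 2 • x ∈ L := Iff.rfl

/-- A (unitary, projective) `m`-representation of `G` on `H`: a Borel map `U` from `G` to the
unitary group of `H` with `U x ∘ U y = m x y • U (x + y)` and `U 0 = 1`.

The Borel condition is that every orbit map `x ↦ U x ψ` is Borel with separable range. If `H` is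
separable this is the usual Borel measurability for the strong (equivalently, weak) operator
topology. It is also the same thing for arbitrary `H` when `G` is Polish, because a Borel map from
a Polish space to a metric space has separable range. -/
structure MRep {G : Type*} [AddCommGroup G] [MeasurableSpace G] (m : G → G → Circle)
    (H : Type*) [NormedAddCommGroup H] [InnerProductSpace ℂ H] where
  toFun : G → (H ≃ₗᵢ[ℂ] H)
  map_zero : ∀ ψ, toFun 0 ψ = ψ
  map_mul : ∀ x y ψ, toFun x (toFun y ψ) = (m x y : ℂ) • toFun (x + y) ψ
  borel : ∀ ψ, StronglyMeasurable fun x => toFun x ψ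

namespace MRep

variable {G : Type*} [AddCommGroup G] [MeasurableSpace G]
  {H : Type*} [NormedAddCommGroup H] [InnerProductSpace ℂ H]

instance {m : G → G → Circle} : CoeFun (MRep m H) (fun _ => G → (H ≃ₗᵢ[ℂ] H)) := ⟨toFun⟩

/-- `K` is stable under all operators `W x`. -/
def IsInvariant {m : G → G → Circle} (W : MRep m H) (K : Submodule ℂ H) : Prop :=
  ∀ x, ∀ ψ ∈ K, W x ψ ∈ K

/-- The subspace `K` is irreducible under `W`: it is a nonzero closed invariant subspace, and its
only closed invariant subspaces are `0` and `K`. -/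
structure IsIrreducibleOn {m : G → G → Circle} (W : MRep m H) (K : Submodule ℂ H) : Prop where
  isClosed : IsClosed (K : Set H)
  invariant : W.IsInvariant K
  ne_bot : K ≠ ⊥
  eq_bot_or_eq : ∀ N : Submodule ℂ H, N ≤ K → IsClosed (N : Set H) → W.IsInvariant N →
    N = ⊥ ∨ N = K

/-- `W` is irreducible (on the whole space `H`). -/
def IsIrreducible {m : G → G → Circle} (W : MRep m H) : Prop :=
  W.IsIrreducibleOn ⊤

/-- The vacuum space `H^L`: the vectors fixed by all `W a`, `a ∈ L`. -/
def vacuum {m : G → G → Circle} (W : MRep m H) (L : AddSubgroup G) : Submodule ℂ H where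
  carrier := {ψ | ∀ a ∈ L, W a ψ = ψ}
  add_mem' hφ hψ a ha := by rw [map_add, hφ a ha, hψ a ha]
  zero_mem' a _ := _root_.map_zero _
  smul_mem' c ψ hψ a ha := by rw [_root_.map_smul, hψ a ha]

theorem isClosed_vacuum {m : G → G → Circle} (W : MRep m H) (L : AddSubgroup G) :
    IsClosed (W.vacuum L : Set H) := by
  have : (W.vacuum L : Set H) = ⋂ a ∈ L, {ψ | W a ψ = ψ} := by
    ext ψ
    simp [vacuum]
  rw [this]
  exact isClosed_biInter fun a _ => isClosed_eq (W a).continuous continuous_id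

instance {m : G → G → Circle} [CompleteSpace H] (W : MRep m H) (L : AddSubgroup G) :
    CompleteSpace (W.vacuum L) :=
  (W.isClosed_vacuum L).completeSpace_coe

section VacuumRep

variable [TopologicalSpace G] {m : Bicharacter G}

/-- If `2x ∈ L` then `W x` commutes with `W a` for every `a ∈ L`. -/
theorem comm_of_mem_half (W : MRep m H) (hm : m.IsAlternating) {L : AddSubgroup G}
    (hL : m.IsIsotropic L) {x : G} (hx : x ∈ halfSubgroup L) {a : G} (ha : a ∈ L) (ψ : H) :
    W a (W x ψ) = W x (W a ψ) := by
  have h1 : m a x * m a x = 1 := by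
    rw [← m.map_add_right, ← two_nsmul]
    exact hL a ha _ hx
  have h2 : m a x = m x a :=
    (eq_inv_of_mul_eq_one_left h1).trans (eq_inv_of_mul_eq_one_right (hm.mul_swap a x)).symm
  rw [W.map_mul, W.map_mul, h2, add_comm]

theorem apply_mem_vacuum (W : MRep m H) (hm : m.IsAlternating) {L : AddSubgroup G}
    (hL : m.IsIsotropic L) {x : G} (hx : x ∈ halfSubgroup L) {ψ : H} (hψ : ψ ∈ W.vacuum L) :
    W x ψ ∈ W.vacuum L := by
  intro a ha
  rw [W.comm_of_mem_half hm hL hx ha, hψ a ha]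

theorem symm_apply_mem_vacuum (W : MRep m H) (hm : m.IsAlternating) {L : AddSubgroup G}
    (hL : m.IsIsotropic L) {x : G} (hx : x ∈ halfSubgroup L) {ψ : H} (hψ : ψ ∈ W.vacuum L) :
    (W x).symm ψ ∈ W.vacuum L := by
  intro a ha
  apply (W x).injective
  rw [← W.comm_of_mem_half hm hL hx ha, (W x).apply_symm_apply, hψ a ha]

/-- `W^L`: the `m`-representation of `L/2` on `H^L` given by restricting `W`. -/
def vacuumRep (W : MRep m H) (hm : m.IsAlternating) {L : AddSubgroup G}
    (hL : m.IsIsotropic L) :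
    MRep (fun x y : halfSubgroup L => m x y) (W.vacuum L) where
  toFun x :=
    { toFun := fun ψ => ⟨W x ψ, W.apply_mem_vacuum hm hL x.2 ψ.2⟩
      invFun := fun ψ => ⟨(W x).symm ψ, W.symm_apply_mem_vacuum hm hL x.2 ψ.2⟩
      left_inv := fun ψ => Subtype.ext ((W x).symm_apply_apply ψ)
      right_inv := fun ψ => Subtype.ext ((W x).apply_symm_apply ψ)
      map_add' := fun φ ψ => Subtype.ext (map_add (W x) (φ : H) ψ)
      map_smul' := fun c ψ => Subtype.ext (_root_.map_smul (W x) c (ψ : H))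
      norm_map' := fun ψ => (W x).norm_map ψ }
  map_zero ψ := Subtype.ext (W.map_zero ψ)
  map_mul x y ψ := Subtype.ext (W.map_mul x y ψ)
  borel ψ := by
    refine (Embedding.comp_stronglyMeasurable_iff Topology.IsEmbedding.subtypeVal).mp ?_
    exact (W.borel (ψ : H)).comp_measurable measurable_subtype_coe

end VacuumRep

end MRep

end

/-! The key point is that every nonzero closed `W`-invariant subspace `K` meets `H^L`. Averaging
over the compact group `L` projects `K` into `K ∩ H^L`, and for `ψ ∈ K` the average of `W y ψ` is
`W y` applied to the Fourier coefficient of `a ↦ W a ψ` at the character `m(·, 2y)` of `L`. Since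
`G` is 2-regular, all characters `m(·, z)` occur; by nondegeneracy and the Stone–Weierstrass
theorem they span a dense space of continuous functions on `L`, so one of the coefficients is
nonzero.

In the other direction, `W x` maps `H^L` into itself for `x ∈ L/2` and into its orthogonal
complement for `x ∉ L/2`. Hence the subspace generated by a `W^L`-invariant subspace `N` of `H^L`
is orthogonal to the complement of `N` in `H^L`.

Finally `L`, being its own annihilator and compact, is open, so it has finite index in the compact
group `L/2`. Orbits under `W^L` therefore span finite-dimensional spaces, which yields the
decomposition into irreducible subspaces as well as the finite dimension of `H^L`. -/

open Function Filter Topology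
open scoped BoundedContinuousFunction NNReal

theorem dense_span_of_separatesPoints {X 𝕜 : Type*} [TopologicalSpace X] [CompactSpace X]
    [RCLike 𝕜] (S : Submonoid C(X, 𝕜)) (hstar : ∀ f ∈ S, star f ∈ S)
    (hsep : ((fun f : C(X, 𝕜) => (f : X → 𝕜)) '' S).SeparatesPoints) :
    Dense (Submodule.span 𝕜 (S : Set C(X, 𝕜)) : Set C(X, 𝕜)) := by
  have hunion : (S : Set C(X, 𝕜)) ∪ star (S : Set C(X, 𝕜)) = S :=
    Set.union_eq_left.mpr fun f hf => star_star f ▸ hstar _ hf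
  have hspan : Subalgebra.toSubmodule (StarAlgebra.adjoin 𝕜 (S : Set C(X, 𝕜))).toSubalgebra =
      Submodule.span 𝕜 (S : Set C(X, 𝕜)) := by
    rw [StarAlgebra.adjoin_eq_span, hunion, Submonoid.closure_eq]
  have htop := ContinuousMap.starSubalgebra_topologicalClosure_eq_top_of_separatesPoints
    (StarAlgebra.adjoin 𝕜 (S : Set C(X, 𝕜))) fun x y hxy =>
      let ⟨_, ⟨f, hf, hfx⟩, hne⟩ := hsep hxy
      ⟨_, ⟨f, StarAlgebra.subset_adjoin 𝕜 _ hf, hfx⟩, hne⟩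
  rw [Submodule.dense_iff_topologicalClosure_eq_top, ← hspan]
  exact congr_arg (Subalgebra.toSubmodule <| StarSubalgebra.toSubalgebra ·) htop

section Integral

variable {X E : Type*} [TopologicalSpace X] [MeasurableSpace X] {μ : Measure X}
  [NormedAddCommGroup E] {f : X → E}

theorem ae_eq_zero_of_forall_integral_nnreal_smul_eq_zero [HasOuterApproxClosed X] [BorelSpace X]
    [NormedSpace ℝ E] [CompleteSpace E] (hf : Integrable f μ)
    (h : ∀ g : X →ᵇ ℝ≥0, ∫ x, g x • f x ∂μ = 0) : f =ᵐ[μ] 0 := by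
  refine ae_eq_zero_of_forall_setIntegral_isClosed_eq_zero hf fun F hF => ?_
  have hlim : Tendsto (fun n => ∫ x, hF.apprSeq n x • f x ∂μ) atTop
      (𝓝 (∫ x, F.indicator f x ∂μ)) := by
    refine tendsto_integral_of_dominated_convergence (fun x => ‖f x‖)
      (fun n => (hF.apprSeq n).continuous.aestronglyMeasurable.smul hf.aestronglyMeasurable)
      hf.norm (fun n => .of_forall fun x => ?_) (.of_forall fun x => ?_)
    · rw [NNReal.smul_def, norm_smul, NNReal.norm_eq]
      exact mul_le_of_le_one_left (norm_nonneg _)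
        (HasOuterApproxClosed.apprSeq_apply_le_one hF n x)
    · have hx := tendsto_pi_nhds.mp (HasOuterApproxClosed.tendsto_apprSeq hF) x
      by_cases hxF : x ∈ F <;> simpa [hxF] using hx.smul_const (f x)
  rw [← integral_indicator hF.measurableSet]
  exact tendsto_nhds_unique hlim (by simp only [h, tendsto_const_nhds])

variable [CompactSpace X] [OpensMeasurableSpace X] [NormedSpace ℂ E]

theorem integrable_continuousMap_smul (hf : Integrable f μ) (g : C(X, ℂ)) :
    Integrable (fun x => g x • f x) μ :=
  hf.bdd_smul ‖g‖ g.continuous.aestronglyMeasurable (.of_forall g.norm_coe_le_norm)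

theorem integral_smul_eq_zero_of_dense_span (hf : Integrable f μ) {S : Set C(X, ℂ)}
    (hS : Dense (Submodule.span ℂ S : Set C(X, ℂ))) (h : ∀ g ∈ S, ∫ x, g x • f x ∂μ = 0)
    (g : C(X, ℂ)) : ∫ x, g x • f x ∂μ = 0 := by
  let T : C(X, ℂ) →L[ℂ] E := LinearMap.mkContinuous
    { toFun g := ∫ x, g x • f x ∂μ
      map_add' g₁ g₂ := by
        simp only [ContinuousMap.add_apply, add_smul]
        exact integral_add (integrable_continuousMap_smul hf g₁)
          (integrable_continuousMap_smul hf g₂)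
      map_smul' c g := by
        simp only [ContinuousMap.smul_apply, smul_assoc, integral_smul, RingHom.id_apply] }
    (∫ x, ‖f x‖ ∂μ) fun g => by
      rw [mul_comm, ← integral_const_mul]
      refine norm_integral_le_of_norm_le (hf.norm.const_mul _) (.of_forall fun x => ?_)
      rw [norm_smul]
      gcongr
      exact g.norm_coe_le_norm x
  have hT : T = 0 := ContinuousLinearMap.ext_on hS h
  exact DFunLike.congr_fun hT g

theorem ae_eq_zero_of_integral_smul_eq_zero_of_dense_span [HasOuterApproxClosed X] [BorelSpace X]
    [CompleteSpace E] (hf : Integrable f μ) {S : Set C(X, ℂ)}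
    (hS : Dense (Submodule.span ℂ S : Set C(X, ℂ))) (h : ∀ g ∈ S, ∫ x, g x • f x ∂μ = 0) :
    f =ᵐ[μ] 0 := by
  refine ae_eq_zero_of_forall_integral_nnreal_smul_eq_zero hf fun g => ?_
  exact integral_smul_eq_zero_of_dense_span hf hS h ⟨fun x => ((g x : ℝ) : ℂ), by fun_prop⟩

end Integral

theorem isCompact_halfSubgroup {G : Type*} [AddCommGroup G] [TopologicalSpace G]
    [IsTopologicalAddGroup G] [T2Space G] [LocallyCompactSpace G] [SigmaCompactSpace G]
    (hG : IsTwoRegular G) {L : AddSubgroup G} (hL : IsCompact (L : Set G)) :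
    IsCompact (halfSubgroup L : Set G) := by
  have hcont : Continuous (nsmulAddMonoidHom 2 : G →+ G) := continuous_nsmul 2
  have hhomeo : IsHomeomorph (nsmulAddMonoidHom 2 : G →+ G) :=
    ⟨hcont, AddMonoidHom.isOpenMap_of_sigmaCompact _ hG.surjective hcont, hG⟩
  exact hhomeo.isClosedEmbedding.isCompact_preimage hL

namespace Bicharacter

variable {G : Type*} [AddCommGroup G] [TopologicalSpace G] {b : Bicharacter G}

theorem map_zero_right (b : Bicharacter G) (x : G) : b x 0 = 1 := by
  have h := b.map_add_right x 0 0
  rw [add_zero] at h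
  exact mul_eq_left.mp h.symm

theorem map_neg_right (b : Bicharacter G) (x y : G) : b x (-y) = (b x y)⁻¹ := by
  rw [eq_inv_iff_mul_eq_one, ← b.map_add_right, neg_add_cancel, b.map_zero_right]

theorem IsAlternating.swap (hb : b.IsAlternating) (x y : G) : b y x = (b x y)⁻¹ :=
  eq_inv_of_mul_eq_one_right (hb.mul_swap x y)

theorem IsAlternating.eq_of_forall_eq (hb : b.IsAlternating) (hinj : Injective b.toDual)
    {x y : G} (h : ∀ z, b x z = b y z) : x = y := by
  refine hinj (PontryaginDual.ext fun z => ?_)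
  change b z.toAdd x = b z.toAdd y
  rw [hb.swap x, hb.swap y, h]

/-- The annihilator `S^⊥` of a set `S` with respect to `b`. -/
def annihilator (b : Bicharacter G) (S : Set G) : AddSubgroup G where
  carrier := {y | ∀ a ∈ S, b a y = 1}
  add_mem' hx hy a ha := by rw [b.map_add_right, hx a ha, hy a ha, mul_one]
  zero_mem' a _ := b.map_zero_right a
  neg_mem' hx a ha := by rw [b.map_neg_right, hx a ha, inv_one]

theorem mem_annihilator {S : Set G} {y : G} : y ∈ b.annihilator S ↔ ∀ a ∈ S, b a y = 1 :=
  Iff.rfl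

theorem IsAlternating.subset_annihilator_comm (hb : b.IsAlternating) {S T : Set G} :
    S ⊆ b.annihilator T ↔ T ⊆ b.annihilator S := by
  have key {S T : Set G} (h : S ⊆ b.annihilator T) : T ⊆ b.annihilator S := fun t ht s hs => by
    rw [hb.swap, h hs t ht, inv_one]
  exact ⟨key, key⟩

theorem IsAlternating.isIsotropic_closure (hb : b.IsAlternating) {S : Set G}
    (hS : S ⊆ b.annihilator S) : b.IsIsotropic (AddSubgroup.closure S) := by
  have h : S ⊆ b.annihilator (AddSubgroup.closure S) :=
    hb.subset_annihilator_comm.mp ((AddSubgroup.closure_le _).mpr hS)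
  exact fun x hx y hy => (AddSubgroup.closure_le _).mpr h hy x hx

theorem IsMaximalIsotropic.annihilator_eq (hb : b.IsAlternating) {L : AddSubgroup G}
    (hL : b.IsMaximalIsotropic L) : b.annihilator L = L := by
  refine le_antisymm (fun x hx => ?_) fun y hy a ha => hL.prop a ha y hy
  have hx' : b.IsIsotropic (AddSubgroup.closure (insert x L)) := by
    refine hb.isIsotropic_closure ?_
    rintro y (rfl | hy) z (rfl | hz)
    · exact hb.self _
    · exact hx z hz
    · rw [hb.swap y, hx y hy, inv_one]
    · exact hL.prop z hz y hy
  exact hL.le_of_ge hx' (fun a ha => AddSubgroup.subset_closure (Set.mem_insert_of_mem x ha))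
    (AddSubgroup.subset_closure (Set.mem_insert x _))

theorem continuous_toDual (b : Bicharacter G) : Continuous b.toDual :=
  ContinuousMonoidHom.continuous_of_continuous_uncurry _
    (b.continuous_toFun.comp ((continuous_toAdd.comp continuous_snd).prodMk continuous_fst))

theorem isOpen_annihilator (b : Bicharacter G) {L : AddSubgroup G}
    (hL : IsCompact (L : Set G)) : IsOpen (b.annihilator L : Set G) := by
  have : CompactSpace (Multiplicative L) := isCompact_iff_compactSpace.mp hL
  let i : Multiplicative L →ₜ* Multiplicative G :=
    { toMonoidHom := AddMonoidHom.toMultiplicative L.subtype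
      continuous_toFun := continuous_subtype_val }
  have hpre : (b.annihilator L : Set G) =
      (fun y => PontryaginDual.map i (b.toDual y)) ⁻¹' {1} := by
    ext y
    rw [Set.mem_preimage, Set.mem_singleton_iff, PontryaginDual.ext_iff]
    exact ⟨fun h a => h a.toAdd a.toAdd.2, fun h a ha => h (.ofAdd ⟨a, ha⟩)⟩
  -- the dual of the compact group `L` is discrete
  rw [hpre]
  exact (isOpen_discrete _).preimage
    ((PontryaginDual.map i).continuous_toFun.comp b.continuous_toDual)

/-- The characters `b(·, z)` of `G`, restricted to the subgroup `L` and regarded as complex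
functions, depend multiplicatively on `z`. -/
def restrictChar (b : Bicharacter G) (L : AddSubgroup G) : Multiplicative G →* C(L, ℂ) where
  toFun z :=
    { toFun a := b a z.toAdd
      continuous_toFun := continuous_subtype_val.comp
        (b.continuous_toFun.comp (continuous_subtype_val.prodMk continuous_const)) }
  map_one' := by
    ext a
    simp [b.map_zero_right]
  map_mul' y z := by
    ext a
    simp [b.map_add_right]

theorem restrictChar_apply (b : Bicharacter G) (L : AddSubgroup G) (z : Multiplicative G)
    (a : L) : b.restrictChar L z a = b a z.toAdd :=
  rfl

theorem IsAlternating.dense_span_restrictChar (hb : b.IsAlternating) (hinj : Injective b.toDual)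
    (L : AddSubgroup G) [CompactSpace L] :
    Dense (Submodule.span ℂ (Set.range (b.restrictChar L)) : Set C(L, ℂ)) := by
  refine dense_span_of_separatesPoints (MonoidHom.mrange (b.restrictChar L)) ?_ ?_
  · rintro _ ⟨z, rfl⟩
    refine ⟨z⁻¹, ContinuousMap.ext fun a => ?_⟩
    rw [restrictChar_apply, toAdd_inv, b.map_neg_right, Circle.coe_inv_eq_conj]
    rfl
  · intro x y hxy
    by_contra! h
    refine hxy (Subtype.ext (hb.eq_of_forall_eq hinj fun z => Circle.ext ?_))
    exact h _ ⟨_, ⟨.ofAdd z, rfl⟩, rfl⟩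

end Bicharacter

namespace MRep

section InvariantSubspaces

variable {G : Type*} [AddCommGroup G] [MeasurableSpace G]
  {H : Type*} [NormedAddCommGroup H] [InnerProductSpace ℂ H]
  {m : G → G → Circle} {W : MRep m H} {K : Submodule ℂ H}

theorem symm_apply (W : MRep m H) (x : G) (ψ : H) :
    (W x).symm ψ = (m x (-x) : ℂ)⁻¹ • W (-x) ψ := by
  rw [LinearIsometryEquiv.symm_apply_eq, _root_.map_smul, W.map_mul, add_neg_cancel, W.map_zero,
    inv_smul_smul₀ (Circle.coe_ne_zero _)]

theorem IsInvariant.orthogonal (hK : W.IsInvariant K) : W.IsInvariant Kᗮ := by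
  intro x ψ hψ φ hφ
  rw [← (W x).apply_symm_apply φ, (W x).inner_map_map, W.symm_apply]
  exact hψ _ (K.smul_mem _ (hK (-x) φ hφ))

theorem isInvariant_sSup {𝒦 : Set (Submodule ℂ H)} (h : ∀ K ∈ 𝒦, W.IsInvariant K) :
    W.IsInvariant (sSup 𝒦) := by
  intro x
  change sSup 𝒦 ≤ (sSup 𝒦).comap (W x).toLinearEquiv.toLinearMap
  exact sSup_le fun K hK ψ hψ => le_sSup hK (h K hK x ψ hψ)

/-- The smallest `W`-invariant subspace containing `S`, namely the span of the orbits of the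
vectors in `S`. -/
def orbitSpan (W : MRep m H) (S : Set H) : Submodule ℂ H :=
  Submodule.span ℂ (⋃ x, W x '' S)

theorem apply_mem_orbitSpan (W : MRep m H) {S : Set H} (x : G) {ψ : H} (hψ : ψ ∈ S) :
    W x ψ ∈ W.orbitSpan S :=
  Submodule.subset_span (Set.mem_iUnion_of_mem x (Set.mem_image_of_mem _ hψ))

theorem orbitSpan_le {S : Set H} : W.orbitSpan S ≤ K ↔ ∀ x, ∀ ψ ∈ S, W x ψ ∈ K := by
  simp only [orbitSpan, Submodule.span_le, Set.iUnion_subset_iff, Set.image_subset_iff]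
  rfl

theorem subset_orbitSpan (W : MRep m H) (S : Set H) : S ⊆ W.orbitSpan S := fun ψ hψ =>
  W.map_zero ψ ▸ W.apply_mem_orbitSpan 0 hψ

theorem isInvariant_orbitSpan (W : MRep m H) (S : Set H) : W.IsInvariant (W.orbitSpan S) := by
  intro x
  change W.orbitSpan S ≤ (W.orbitSpan S).comap (W x).toLinearEquiv.toLinearMap
  refine orbitSpan_le.mpr fun y ψ hψ => ?_
  change W x (W y ψ) ∈ W.orbitSpan S
  rw [W.map_mul]
  exact Submodule.smul_mem _ _ (W.apply_mem_orbitSpan _ hψ)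

theorem isIrreducible_iff : W.IsIrreducible ↔
    Nontrivial H ∧ ∀ K : Submodule ℂ H, IsClosed (K : Set H) → W.IsInvariant K →
      K = ⊥ ∨ K = ⊤ := by
  constructor
  · intro hW
    exact ⟨(Submodule.nontrivial_iff ℂ).mp ⟨⊤, ⊥, hW.ne_bot⟩,
      fun K => hW.eq_bot_or_eq K le_top⟩
  · rintro ⟨_, h⟩
    exact ⟨isClosed_univ, fun _ _ _ => Submodule.mem_top, top_ne_bot, fun K _ => h K⟩

theorem IsIrreducible.orthogonal_orbitSpan_eq_bot (hW : W.IsIrreducible) {S : Set H} {ψ : H}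
    (hψ : ψ ∈ S) (hψ₀ : ψ ≠ 0) : (W.orbitSpan S)ᗮ = ⊥ := by
  refine ((isIrreducible_iff.mp hW).2 _ (Submodule.isClosed_orthogonal _)
    (W.isInvariant_orbitSpan S).orthogonal).resolve_right fun htop => hψ₀ ?_
  have hψ' : ψ ∈ (W.orbitSpan S)ᗮ := htop ▸ Submodule.mem_top
  exact inner_self_eq_zero.mp (hψ' ψ (W.subset_orbitSpan S hψ))

theorem IsInvariant.exists_isIrreducibleOn_le_of_finiteDimensional [FiniteDimensional ℂ K]
    (hK : W.IsInvariant K) (hne : K ≠ ⊥) : ∃ N ≤ K, W.IsIrreducibleOn N := by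
  let S : Set (Submodule ℂ H) := {N | N ≤ K ∧ W.IsInvariant N ∧ N ≠ ⊥}
  obtain ⟨N, ⟨hNK, hN, hN₀⟩, hmin⟩ :=
    (measure fun N : Submodule ℂ H => Module.finrank ℂ N).wf.has_min S ⟨K, le_rfl, hK, hne⟩
  have : FiniteDimensional ℂ N := Submodule.finiteDimensional_of_le hNK
  refine ⟨N, hNK, N.closed_of_finiteDimensional, hN, hN₀, fun M hMN _ hM => ?_⟩
  by_contra! h
  exact hmin M ⟨hMN.trans hNK, hM, h.1⟩
    (Submodule.finrank_lt_finrank_of_lt (lt_of_le_of_ne hMN h.2))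

theorem exists_maximal_orthogonal_isIrreducibleOn (W : MRep m H) :
    ∃ 𝒦, Maximal (fun 𝒦 : Set (Submodule ℂ H) =>
      (∀ K ∈ 𝒦, W.IsIrreducibleOn K) ∧ 𝒦.Pairwise (· ⟂ ·)) 𝒦 := by
  refine zorn_subset _ fun c hc hchain => ⟨⋃₀ c, ⟨?_, ?_⟩, fun s => Set.subset_sUnion_of_mem⟩
  · rintro K ⟨s, hs, hK⟩
    exact (hc hs).1 K hK
  · exact (Set.pairwise_sUnion hchain.directedOn).mpr fun s hs => (hc hs).2

theorem exists_isHilbertSum_isIrreducibleOn [CompleteSpace H]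
    (h : ∀ K : Submodule ℂ H, IsClosed (K : Set H) → W.IsInvariant K → K ≠ ⊥ →
      ∃ N ≤ K, W.IsIrreducibleOn N) :
    ∃ 𝒦 : Set (Submodule ℂ H), (∀ K ∈ 𝒦, W.IsIrreducibleOn K) ∧
      IsHilbertSum ℂ (fun K : 𝒦 => (K : Submodule ℂ H))
        (fun K => (K : Submodule ℂ H).subtypeₗᵢ) := by
  obtain ⟨𝒦, h𝒦⟩ := W.exists_maximal_orthogonal_isIrreducibleOn
  obtain ⟨hirr, hpair⟩ := h𝒦.prop
  have hsup : (sSup 𝒦)ᗮ = ⊥ := by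
    by_contra hne
    obtain ⟨N, hN, hNirr⟩ := h _ (Submodule.isClosed_orthogonal _)
      (isInvariant_sSup fun K hK => (hirr K hK).invariant).orthogonal hne
    have hort : ∀ K ∈ 𝒦, K ⟂ N := fun K hK =>
      (Submodule.isOrtho_orthogonal_right _).mono (le_sSup hK) hN
    have hmem : N ∈ 𝒦 := by
      refine h𝒦.le_of_ge (y := insert N 𝒦) ⟨?_, ?_⟩ (Set.subset_insert _ _)
        (Set.mem_insert _ _)
      · exact Set.forall_mem_insert.mpr ⟨hNirr, hirr⟩
      · exact hpair.insert fun K hK _ => ⟨(hort K hK).symm, hort K hK⟩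
    exact hNirr.ne_bot (Submodule.isOrtho_self.mp (hort N hmem))
  have : ∀ K : 𝒦, CompleteSpace (K : Submodule ℂ H) := fun K =>
    (hirr K K.2).isClosed.completeSpace_coe
  refine ⟨𝒦, hirr, IsHilbertSum.mkInternal _ (OrthogonalFamily.of_pairwise fun K N hKN =>
    hpair K.2 N.2 (Subtype.coe_injective.ne hKN)) ?_⟩
  rw [← sSup_eq_iSup', top_le_iff, Submodule.topologicalClosure_eq_top_iff, hsup]

/-- `W` is locally finite if every vector lies in a finite-dimensional invariant subspace. -/
def IsLocallyFinite (W : MRep m H) : Prop :=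
  ∀ ψ, FiniteDimensional ℂ (W.orbitSpan {ψ})

theorem IsLocallyFinite.exists_isIrreducibleOn_le (hW : W.IsLocallyFinite)
    (hK : W.IsInvariant K) (hne : K ≠ ⊥) : ∃ N ≤ K, W.IsIrreducibleOn N := by
  obtain ⟨ψ, hψ, hψ₀⟩ := Submodule.exists_mem_ne_zero_of_ne_bot hne
  have := hW ψ
  have hle : W.orbitSpan {ψ} ≤ K := orbitSpan_le.mpr fun x _ h => h ▸ hK x ψ hψ
  have hψ' : ψ ∈ W.orbitSpan {ψ} := W.subset_orbitSpan _ rfl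
  obtain ⟨N, hN, hNirr⟩ := (W.isInvariant_orbitSpan {ψ})
    |>.exists_isIrreducibleOn_le_of_finiteDimensional (Submodule.ne_bot_iff _ |>.mpr
      ⟨ψ, hψ', hψ₀⟩)
  exact ⟨N, hN.trans hle, hNirr⟩

theorem IsLocallyFinite.finiteDimensional (hW : W.IsLocallyFinite) (hirr : W.IsIrreducible) :
    FiniteDimensional ℂ H := by
  obtain ⟨_, hirr⟩ := isIrreducible_iff.mp hirr
  obtain ⟨ψ, hψ⟩ := exists_ne (0 : H)
  have := hW ψ
  have hne : W.orbitSpan {ψ} ≠ ⊥ :=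
    (Submodule.ne_bot_iff _).mpr ⟨ψ, W.subset_orbitSpan _ rfl, hψ⟩
  have htop : W.orbitSpan {ψ} = ⊤ := (hirr _ (Submodule.closed_of_finiteDimensional _)
    (W.isInvariant_orbitSpan _)).resolve_left hne
  rw [htop] at this
  exact Module.finite_def.mpr (Module.Finite.iff_fg.mp this)

theorem finiteDimensional_orbitSpan_singleton (W : MRep m H) {U : AddSubgroup G}
    [Finite (G ⧸ U)] {ψ : H} (hψ : ψ ∈ W.vacuum U) :
    FiniteDimensional ℂ (W.orbitSpan {ψ}) := by
  let S : Set H := Set.range fun q : G ⧸ U => W q.out ψ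
  have hle : W.orbitSpan {ψ} ≤ Submodule.span ℂ S := by
    refine orbitSpan_le.mpr ?_
    intro x φ hφ
    obtain ⟨u, hu⟩ := QuotientAddGroup.mk_out_eq_add U x
    have hx : W x φ = (m x u : ℂ) • W (x : G ⧸ U).out ψ := by
      rw [hu, ← W.map_mul, hψ u u.2, hφ]
    rw [hx]
    exact Submodule.smul_mem _ _ (Submodule.subset_span ⟨_, rfl⟩)
  have : FiniteDimensional ℂ (Submodule.span ℂ S) :=
    FiniteDimensional.span_of_finite ℂ (Set.finite_range _)
  exact Submodule.finiteDimensional_of_le hle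

end InvariantSubspaces

section Vacuum

variable {G : Type*} [AddCommGroup G] [TopologicalSpace G] [MeasurableSpace G]
  {H : Type*} [NormedAddCommGroup H] [InnerProductSpace ℂ H]
  {m : Bicharacter G} {W : MRep m H} {L : AddSubgroup G} {K : Submodule ℂ H}

theorem apply_apply_comm (W : MRep m H) (hm : m.IsAlternating) (x y : G) (ψ : H) :
    W x (W y ψ) = (m x (2 • y) : ℂ) • W y (W x ψ) := by
  rw [W.map_mul, W.map_mul, smul_smul, add_comm y x, hm.swap x y, two_nsmul, m.map_add_right,
    ← Circle.coe_mul, mul_inv_cancel_right]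

theorem inner_apply_eq_zero (W : MRep m H) (hm : m.IsAlternating) {x : G}
    (hx : 2 • x ∉ m.annihilator L) {φ ψ : H} (hφ : φ ∈ W.vacuum L) (hψ : ψ ∈ W.vacuum L) :
    inner ℂ φ (W x ψ) = 0 := by
  obtain ⟨a, ha, hax⟩ : ∃ a ∈ L, m a (2 • x) ≠ 1 := by
    simpa only [Bicharacter.mem_annihilator, not_forall, exists_prop, SetLike.mem_coe] using hx
  have h : inner ℂ φ (W x ψ) = (m a (2 • x) : ℂ) * inner ℂ φ (W x ψ) :=
    calc inner ℂ φ (W x ψ) = inner ℂ (W a φ) (W a (W x ψ)) := ((W a).inner_map_map _ _).symm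
      _ = (m a (2 • x) : ℂ) * inner ℂ φ (W x ψ) := by
        rw [hφ a ha, W.apply_apply_comm hm, hψ a ha, inner_smul_right]
  by_contra h₀
  exact hax (Circle.ext (mul_right_cancel₀ h₀ ((one_mul _).trans h)).symm)

theorem coe_mem_orthogonal_orbitSpan (hm : m.IsAlternating) (hL : m.IsMaximalIsotropic L)
    {N : Submodule ℂ (W.vacuum L)} (hN : (W.vacuumRep hm hL.prop).IsInvariant N)
    {φ : W.vacuum L} (hφ : φ ∈ Nᗮ) :
    (φ : H) ∈ (W.orbitSpan (Subtype.val '' (N : Set (W.vacuum L))))ᗮ := by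
  suffices h : W.orbitSpan (Subtype.val '' (N : Set (W.vacuum L))) ≤ (ℂ ∙ (φ : H))ᗮ from
    fun v hv => Submodule.mem_orthogonal_singleton_iff_inner_left.mp (h hv)
  refine orbitSpan_le.mpr ?_
  rintro x _ ⟨ψ, hψ, rfl⟩
  rw [Submodule.mem_orthogonal_singleton_iff_inner_right]
  by_cases hx : x ∈ halfSubgroup L
  · exact (Submodule.mem_orthogonal' N φ).mp hφ _ (hN ⟨x, hx⟩ ψ hψ)
  · rw [mem_halfSubgroup, ← hL.annihilator_eq hm] at hx
    exact W.inner_apply_eq_zero hm hx φ.2 ψ.2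

theorem isLocallyFinite_vacuumRep [IsTopologicalAddGroup G] [T2Space G] [LocallyCompactSpace G]
    [SigmaCompactSpace G] (W : MRep m H) (hG : IsTwoRegular G) (hm : m.IsAlternating)
    (hL : m.IsMaximalIsotropic L) (hLc : IsCompact (L : Set G)) :
    (W.vacuumRep hm hL.prop).IsLocallyFinite := by
  intro ψ
  let U : AddSubgroup (halfSubgroup L) := L.addSubgroupOf (halfSubgroup L)
  have hLo : IsOpen (L : Set G) := hL.annihilator_eq hm ▸ m.isOpen_annihilator hLc
  have : CompactSpace (halfSubgroup L) :=
    isCompact_iff_compactSpace.mp (isCompact_halfSubgroup hG hLc)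
  have : Finite (halfSubgroup L ⧸ U) :=
    U.quotient_finite_of_isOpen (hLo.preimage continuous_subtype_val)
  exact (W.vacuumRep hm hL.prop).finiteDimensional_orbitSpan_singleton (U := U)
    fun a ha => Subtype.ext (ψ.2 a ha)

theorem integrable_apply (W : MRep m H) (ψ : H) (μ : Measure L) [IsFiniteMeasure μ] :
    Integrable (fun a : L => W a ψ) μ :=
  .of_bound ((W.borel ψ).comp_measurable measurable_subtype_coe).aestronglyMeasurable ‖ψ‖
    (.of_forall fun a => ((W a).norm_map ψ).le)

theorem apply_integral (W : MRep m H) (x : G) (f : L → H) (μ : Measure L) :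
    W x (∫ a, f a ∂μ) = ∫ a, W x (f a) ∂μ :=
  ((W x).toContinuousLinearEquiv.integral_comp_comm f).symm

section Average

variable [IsTopologicalAddGroup G] [BorelSpace G] [CompactSpace L]

/-- The mean of `W a ψ` over the compact group `L`, with respect to the Haar measure of total
mass one. For isotropic `L` it is the orthogonal projection of `ψ` to the vacuum space `H^L`. -/
noncomputable def average (W : MRep m H) (L : AddSubgroup G) [CompactSpace L] (ψ : H) : H :=
  ∫ a : L, W a ψ ∂(Measure.addHaarMeasure ⊤)

theorem average_mem_vacuum (W : MRep m H) (hL : m.IsIsotropic L) (ψ : H) :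
    W.average L ψ ∈ W.vacuum L := by
  intro b hb
  have hadd (a : L) : W b (W a ψ) = W ((⟨b, hb⟩ + a : L) : G) ψ := by
    rw [W.map_mul, hL b hb a a.2, Circle.coe_one, one_smul, AddSubgroup.coe_add]
  simp only [average, W.apply_integral, hadd]
  exact integral_add_left_eq_self (fun a : L => W a ψ) ⟨b, hb⟩

theorem IsInvariant.average_mem [CompleteSpace H] (hK : W.IsInvariant K)
    (hKc : IsClosed (K : Set H)) {ψ : H} (hψ : ψ ∈ K) : W.average L ψ ∈ K := by
  have : IsProbabilityMeasure (Measure.addHaarMeasure (⊤ : TopologicalSpace.PositiveCompacts L)) :=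
    ⟨Measure.addHaarMeasure_self⟩
  exact (K.restrictScalars ℝ).convex.integral_mem hKc (.of_forall fun a => hK a ψ hψ)
    (W.integrable_apply ψ _)

theorem average_apply (W : MRep m H) (hm : m.IsAlternating) (y : G) (ψ : H) :
    W.average L (W y ψ) = W y
      (∫ a : L, m.restrictChar L (.ofAdd (2 • y)) a • W a ψ ∂(Measure.addHaarMeasure ⊤)) := by
  rw [average, W.apply_integral]
  congr! 2 with a
  rw [W.apply_apply_comm hm, _root_.map_smul]
  rfl

theorem exists_average_apply_ne_zero [T2Space G] [SecondCountableTopology G] [CompleteSpace H]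
    (W : MRep m H) (hG : Surjective fun x : G => 2 • x) (hm : m.IsAlternating)
    (hinj : Injective m.toDual) (L : AddSubgroup G) [CompactSpace L] {ψ : H} (hψ : ψ ≠ 0) :
    ∃ y, W.average L (W y ψ) ≠ 0 := by
  by_contra! hzero
  have : SecondCountableTopology L :=
    TopologicalSpace.Subtype.secondCountableTopology (L : Set G)
  let μ : Measure L := Measure.addHaarMeasure ⊤
  have hcoeff : ∀ g ∈ Set.range (m.restrictChar L), ∫ a, g a • W a ψ ∂μ = 0 := by
    rintro _ ⟨z, rfl⟩
    obtain ⟨y, hy⟩ := hG z.toAdd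
    have hy₀ := hzero y
    rw [W.average_apply hm, (W y).map_eq_zero_iff] at hy₀
    obtain rfl : .ofAdd (2 • y) = z := hy
    exact hy₀
  have hae : (fun a : L => W a ψ) =ᵐ[μ] 0 :=
    ae_eq_zero_of_integral_smul_eq_zero_of_dense_span (W.integrable_apply ψ μ)
      (hm.dense_span_restrictChar hinj L) hcoeff
  obtain ⟨a, ha⟩ := hae.exists
  exact hψ ((W a).map_eq_zero_iff.mp ha)

end Average

variable [IsTopologicalAddGroup G] [T2Space G] [SecondCountableTopology G] [BorelSpace G]
  [CompleteSpace H]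

theorem IsInvariant.eq_bot_of_disjoint_vacuum (hG : Surjective fun x : G => 2 • x)
    (hm : m.IsAlternating) (hinj : Injective m.toDual) (hL : m.IsIsotropic L)
    (hLc : IsCompact (L : Set G)) (hK : W.IsInvariant K) (hKc : IsClosed (K : Set H))
    (hdisj : Disjoint K (W.vacuum L)) : K = ⊥ := by
  have : CompactSpace L := isCompact_iff_compactSpace.mp hLc
  by_contra hne
  obtain ⟨ψ, hψ, hψ₀⟩ := Submodule.exists_mem_ne_zero_of_ne_bot hne
  obtain ⟨y, hy⟩ := W.exists_average_apply_ne_zero hG hm hinj L hψ₀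
  exact hy (Submodule.disjoint_def.mp hdisj _ (hK.average_mem hKc (hK y ψ hψ))
    (W.average_mem_vacuum hL _))

theorem IsIrreducible.vacuumRep (hG : Surjective fun x : G => 2 • x)
    (hm : m.IsAlternating) (hinj : Injective m.toDual) (hL : m.IsMaximalIsotropic L)
    (hLc : IsCompact (L : Set G)) (hW : W.IsIrreducible) :
    (W.vacuumRep hm hL.prop).IsIrreducible := by
  refine isIrreducible_iff.mpr ⟨?_, fun N hNc hN => or_iff_not_imp_left.mpr fun hne => ?_⟩
  · rw [Submodule.nontrivial_iff_ne_bot]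
    intro hbot
    exact hW.ne_bot (hW.invariant.eq_bot_of_disjoint_vacuum hG hm hinj hL.prop hLc isClosed_univ
      (hbot ▸ disjoint_bot_right))
  · obtain ⟨ψ, hψ, hψ₀⟩ := Submodule.exists_mem_ne_zero_of_ne_bot hne
    have hort := hW.orthogonal_orbitSpan_eq_bot (Set.mem_image_of_mem Subtype.val hψ)
      (ZeroMemClass.coe_eq_zero.not.mpr hψ₀)
    have := hNc.completeSpace_coe
    refine Submodule.orthogonal_eq_bot_iff.mp ((Submodule.eq_bot_iff _).mpr fun φ hφ => ?_)
    have hφ' := coe_mem_orthogonal_orbitSpan hm hL hN hφ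
    rw [hort, Submodule.mem_bot] at hφ'
    exact ZeroMemClass.coe_eq_zero.mp hφ'

theorem IsIrreducible.of_vacuumRep (hG : Surjective fun x : G => 2 • x)
    (hm : m.IsAlternating) (hinj : Injective m.toDual) (hL : m.IsIsotropic L)
    (hLc : IsCompact (L : Set G)) (hW : (W.vacuumRep hm hL).IsIrreducible) :
    W.IsIrreducible := by
  obtain ⟨_, hirr⟩ := isIrreducible_iff.mp hW
  refine isIrreducible_iff.mpr
    ⟨(W.vacuum L).subtype_injective.nontrivial, fun K hKc hK => ?_⟩
  rcases hirr (K.comap (W.vacuum L).subtype) (hKc.preimage continuous_subtype_val)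
    (fun x ψ hψ => hK x ψ hψ) with h | h
  · left
    exact hK.eq_bot_of_disjoint_vacuum hG hm hinj hL hLc hKc
      (Submodule.disjoint_iff_comap_eq_bot.mpr h).symm
  · right
    have := hKc.completeSpace_coe
    have hle : W.vacuum L ≤ K := Submodule.comap_subtype_eq_top.mp h
    refine Submodule.orthogonal_eq_bot_iff.mp (hK.orthogonal.eq_bot_of_disjoint_vacuum hG hm hinj
      hL hLc K.isClosed_orthogonal ?_)
    exact K.orthogonal_disjoint.symm.mono_right hle

end Vacuum

end MRep

theorem lemma4p4 {G : Type*} [AddCommGroup G] [TopologicalSpace G] [IsTopologicalAddGroup G]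
    [T2Space G] [LocallyCompactSpace G] [SecondCountableTopology G]
    [MeasurableSpace G] [BorelSpace G]
    (hG : IsTwoRegular G)
    (m : Bicharacter G) (hm : m.IsSymplectic)
    (L : AddSubgroup G) (hL : m.IsMaximalIsotropic L) (hLc : IsCompact (L : Set G))
    {H : Type*} [NormedAddCommGroup H] [InnerProductSpace ℂ H] [CompleteSpace H]
    (W : MRep m H) :
    (∃ 𝒦 : Set (Submodule ℂ (W.vacuum L)),
      (∀ K ∈ 𝒦, (W.vacuumRep hm.alternating hL.prop).IsIrreducibleOn K) ∧
      IsHilbertSum ℂ (fun K : 𝒦 => (K : Submodule ℂ (W.vacuum L)))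
        (fun K => (K : Submodule ℂ (W.vacuum L)).subtypeₗᵢ)) ∧
    (W.IsIrreducible ↔ (W.vacuumRep hm.alternating hL.prop).IsIrreducible) ∧
    (W.IsIrreducible → FiniteDimensional ℂ (W.vacuum L)) := by
  have hinj := hm.isHomeomorph_toDual.injective
  have hfin := W.isLocallyFinite_vacuumRep hG hm.alternating hL hLc
  have hirr : W.IsIrreducible → (W.vacuumRep hm.alternating hL.prop).IsIrreducible :=
    fun hW => hW.vacuumRep hG.2 hm.alternating hinj hL hLc
  exact ⟨MRep.exists_isHilbertSum_isIrreducibleOn fun K _ hK hne =>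
      hfin.exists_isIrreducibleOn_le hK hne,
    ⟨hirr, fun hW => hW.of_vacuumRep hG.2 hm.alternating hinj hL.prop hLc⟩,
    fun hW => hfin.finiteDimensional (hirr hW)⟩
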